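/- Let $\Theta\subseteq\mathbb R$ be an interval and consider a canonical one-parameter exponential family with parameter space $\Theta$: a measure $\nu$ on a measurable space $\mathcal X$, measurable functions $h\ge 0$ and $T$ on $\mathcal X$ and a function $A$ on $\Theta$ such that, for every $\theta\in\Theta$, $f(x\mid\theta)=h(x)\exp[\theta T(x)-A(\theta)]$ is a probability density with respect to $\nu$. For a sample $\mathbf x=(x_1,\dots,x_n)$ put $f(\mathbf x\mid\theta)=\prod_{i=1}^n f(x_i\mid\theta)$. Let $\theta_0$ be an interior point of $\Theta$ such that $A$ has three bounded derivatives in a neighborhood of $\theta_0$, let $\gamma>0$ with $\gamma\ne 1$, and let $\Theta_1\subseteq\Theta$ be the set of parameter values that the alternative allows (for instance $\Theta\cap(\theta_0,\infty)$ or $\Theta\cap(-\infty,\theta_0)$ for a one-sided test). For a probability measure $\pi$ concentrated on $\Theta_1$ (an alternative hypothesis), the Bayes factor against $H_0:\theta=\theta_0$ is $\mathrm{BF}_{\pi}(\mathbf x)=\int f(\mathbf x\mid\theta)\,\pi(d\theta)\,/\,f(\mathbf x\mid\theta_0)$. A value $\theta^*$ is said to define a $\mathrm{UMPBT}(\gamma)$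 for sample size $n$ if $\theta^*\in\Theta_1$ and $$P_{\theta_t}\bigl[\mathrm{BF}_{\delta_{\theta^*}}(\mathbf x)>\gamma\bigr]\ \ge\ P_{\theta_t}\bigl[\mathrm{BF}_{\pi_2}(\mathbf x)>\gamma\bigr]$$ for every $\theta_t\in\Theta$ and every probability measure $\pi_2$ concentrated on $\Theta_1$, where under $P_{\theta_t}$ the observations $x_1,\dots,x_n$ are i.i.d. with density $f(\cdot\mid\theta_t)$. Let $$g_\gamma(\theta,\theta_0)=\frac{\log\gamma+n[A(\theta)-A(\theta_0)]}{\theta-\theta_0}.$$ (1) Let $n\ge1$, and let $\theta^*$ be a value that defines a $\mathrm{UMPBT}(\gamma)$ for sample size $n$ and satisfies $\frac{d}{d\theta}g_\gamma(\theta^*,\theta_0)=0$ (the derivative being taken within $\Theta$). Then for some $t$ strictly between $\theta_0$ and $\theta^*$, $$|\theta^*-\theta_0|=\sqrt{\frac{2\log\gamma}{n\,A''(t)}}.$$ (2) Let $(\theta^*_n)$ be a sequence such that, for all sufficiently large $n$, $\theta^*_n$ defines a $\mathrm{UMPBT}(\gamma)$ for sample size $n$ and satisfies $\frac{d}{d\theta}g_\gamma(\theta^*_n,\theta_0)=0$.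 Let $X_1,X_2,\dots$ be i.i.d. with density $f(\cdot\mid\theta_0)$, and let $\mathrm{BF}_{10}$ denote the Bayes factor of $H_1:\theta=\theta_n^*$ against $H_0:\theta=\theta_0$ based on $X_1,\dots,X_n$. Then, as $n\to\infty$, $\log(\mathrm{BF}_{10})$ converges in distribution to the normal distribution with mean $-\log\gamma$ and variance $2\log\gamma$. -/

import Mathlib

open MeasureTheory ProbabilityTheory Filter Topology

noncomputable section

namespace UMPBT

variable {𝓧 : Type*} [MeasurableSpace 𝓧]

/-- The density `f(x | θ) = h(x) exp[θ T(x) - A(θ)]` of one observation, in canonical form. -/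
def density (h T : 𝓧 → ℝ) (A : ℝ → ℝ) (θ : ℝ) (x : 𝓧) : ℝ :=
  h x * Real.exp (θ * T x - A θ)

/-- The distribution of one observation with parameter `θ`: it has the density `f(· | θ)` with
respect to the underlying measure `ν`. -/
def law (ν : Measure 𝓧) (h T : 𝓧 → ℝ) (A : ℝ → ℝ) (θ : ℝ) : Measure 𝓧 :=
  ν.withDensity fun x => ENNReal.ofReal (density h T A θ x)

/-- `h`, `T`, `A` define a canonical one-parameter exponential family on the parameter space `Θ`,
an interval: for every `θ ∈ Θ` the function `f(· | θ)` is a probability density with respect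
to `ν`. Nothing is required of `A` outside `Θ`. -/
structure IsExpFamily (ν : Measure 𝓧) (h T : 𝓧 → ℝ) (A : ℝ → ℝ) (Θ : Set ℝ) : Prop where
  measurable_h : Measurable h
  measurable_T : Measurable T
  h_nonneg : ∀ x, 0 ≤ h x
  interval : Θ.OrdConnected
  lintegral_density : ∀ θ ∈ Θ, ∫⁻ x, ENNReal.ofReal (density h T A θ x) ∂ν = 1

/-- The density `f(x₁, …, xₙ | θ) = ∏ f(xᵢ | θ)` of a random sample of size `n`. -/
def sampleDensity (h T : 𝓧 → ℝ) (A : ℝ → ℝ) {n : ℕ} (θ : ℝ) (x : Fin n → 𝓧) : ℝ :=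
  ∏ i, density h T A θ (x i)

/-- The distribution of a random sample of size `n` with parameter `θ`. -/
def sampleLaw (ν : Measure 𝓧) (h T : 𝓧 → ℝ) (A : ℝ → ℝ) (n : ℕ) (θ : ℝ) :
    Measure (Fin n → 𝓧) :=
  Measure.pi fun _ => law ν h T A θ

/-- The marginal density `m(x) = ∫ f(x | θ) π(dθ)` of a sample under the prior `π`. -/
def marginal (h T : 𝓧 → ℝ) (A : ℝ → ℝ) {n : ℕ} (π : Measure ℝ) (x : Fin n → 𝓧) : ENNReal :=
  ∫⁻ θ, ENNReal.ofReal (sampleDensity h T A θ x) ∂π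

/-- The Bayes factor `BF₁₀(x) = m₁(x) / m₀(x)` between `H₁ : θ ∼ π₁` and the point null
hypothesis `H₀ : θ = θ₀`, whose prior is the point mass at `θ₀`. -/
def bayesFactor (h T : 𝓧 → ℝ) (A : ℝ → ℝ) (θ₀ : ℝ) {n : ℕ} (π₁ : Measure ℝ)
    (x : Fin n → 𝓧) : ENNReal :=
  marginal h T A π₁ x / marginal h T A (Measure.dirac θ₀) x

/-- An alternative hypothesis `H : θ ∼ π` that requires `θ` to belong to `Θ₁`. -/
def IsAlternative (Θ₁ : Set ℝ) (π : Measure ℝ) : Prop :=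
  IsProbabilityMeasure π ∧ ∀ᵐ θ ∂π, θ ∈ Θ₁

/-- The prior `π₁` defines a uniformly most powerful Bayesian test for evidence threshold `γ`,
based on a sample of size `n`, of `H₀ : θ = θ₀` against alternatives that require `θ ∈ Θ₁`:
whatever the data-generating parameter `θt ∈ Θ`, no alternative hypothesis `π₂` makes it more
probable that its Bayes factor against `H₀` exceeds `γ`. -/
def IsUMPBT (ν : Measure 𝓧) (h T : 𝓧 → ℝ) (A : ℝ → ℝ) (Θ Θ₁ : Set ℝ) (θ₀ γ : ℝ) (n : ℕ)
    (π₁ : Measure ℝ) : Prop :=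
  IsAlternative Θ₁ π₁ ∧
    ∀ θt ∈ Θ, ∀ π₂ : Measure ℝ, IsAlternative Θ₁ π₂ →
      sampleLaw ν h T A n θt {x | ENNReal.ofReal γ < bayesFactor h T A θ₀ π₂ x} ≤
        sampleLaw ν h T A n θt {x | ENNReal.ofReal γ < bayesFactor h T A θ₀ π₁ x}

/-- The objective function `g_γ(θ, θ₀)`, in canonical form and for samples of size `n`. -/
def g (A : ℝ → ℝ) (γ : ℝ) (n : ℕ) (θ₀ θ : ℝ) : ℝ :=
  (Real.log γ + n * (A θ - A θ₀)) / (θ - θ₀)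

/-- `θs` is a value of `θ` that defines a UMPBT(`γ`) (through the point mass at `θs`) and at which
the derivative of `g_γ(·, θ₀)`, as a function on the parameter space `Θ`, exists and is zero. -/
def IsStationaryUMPBT (ν : Measure 𝓧) (h T : 𝓧 → ℝ) (A : ℝ → ℝ) (Θ Θ₁ : Set ℝ) (θ₀ γ : ℝ)
    (n : ℕ) (θs : ℝ) : Prop :=
  IsUMPBT ν h T A Θ Θ₁ θ₀ γ n (Measure.dirac θs) ∧ HasDerivWithinAt (g A γ n θ₀) 0 Θ θs

/-- `A` has three bounded derivatives in a neighborhood of `θ₀`. -/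
def HasThreeBoundedDerivs (A : ℝ → ℝ) (θ₀ : ℝ) : Prop :=
  ∃ U ∈ 𝓝 θ₀, ∃ C : ℝ, ∀ θ ∈ U, ∀ k < 3,
    DifferentiableAt ℝ (iteratedDeriv k A) θ ∧ |iteratedDeriv (k + 1) A θ| ≤ C

/-- The weight of evidence `log BF₁₀(x)` for the alternative `H₁ : θ = θ₁`. -/
def weightOfEvidence (h T : 𝓧 → ℝ) (A : ℝ → ℝ) (θ₀ θ₁ : ℝ) {n : ℕ} (x : Fin n → 𝓧) : ℝ :=
  Real.log (bayesFactor h T A θ₀ (Measure.dirac θ₁) x).toReal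

end UMPBT

end

/-!
Stationarity of `g_γ(·, θ₀)` at `θs` determines the derivative of `A` there, and says that the gap
at `θ₀` between `A` and its tangent line at `θs` equals `log γ / n`. As `θs` may be an endpoint of
`Θ`, the derivative is one-sided; Taylor's formula at `θs` still equates this gap with
`(θs - θ₀)² A''(t) / 2`, which is (1).

`A` is a cumulant generating function up to translation and a constant, so `A''` is a variance and,
once nonzero somewhere, positive everywhere inside `Θ`. Strict convexity forces `θs → θ₀` as the gap
vanishes, whence `n (θs - θ₀)² → 2 log γ / A''(θ₀)`. Finally `log BF₁₀` is `θs - θ₀` times the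
centered sum of the `T(Xᵢ)`, minus `n` times the gap at `θs` between `A` and its tangent line at
`θ₀`. This drift tends to `log γ`, and the central limit theorem gives (2).
-/

theorem tangent_le_of_convexOn {s : Set ℝ} {f : ℝ → ℝ} {d x y : ℝ} (hf : ConvexOn ℝ s f)
    (hx : x ∈ s) (hy : y ∈ s) (hd : HasDerivWithinAt f d s x) : f x + d * (y - x) ≤ f y := by
  rcases lt_trichotomy x y with hxy | rfl | hyx
  · have := hf.le_slope_of_hasDerivWithinAt hx hy hxy hd
    rw [slope_def_field, le_div_iff₀ (sub_pos.2 hxy)] at this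
    linarith
  · simp
  · have := hf.slope_le_of_hasDerivWithinAt hy hx hyx hd
    rw [slope_def_field, div_le_iff₀ (sub_pos.2 hyx)] at this
    linarith

theorem tangent_lt_of_strictConvexOn {s : Set ℝ} {f : ℝ → ℝ} {d x y : ℝ}
    (hf : StrictConvexOn ℝ s f) (hx : x ∈ s) (hy : y ∈ s) (hxy : x ≠ y)
    (hd : HasDerivWithinAt f d s x) : f x + d * (y - x) < f y := by
  rcases hxy.lt_or_gt with hxy | hyx
  · have := hf.lt_slope_of_hasDerivWithinAt hx hy hxy hd
    rw [slope_def_field, lt_div_iff₀ (sub_pos.2 hxy)] at this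
    linarith
  · have := hf.slope_lt_of_hasDerivWithinAt hy hx hyx hd
    rw [slope_def_field, div_lt_iff₀ (sub_pos.2 hyx)] at this
    linarith

theorem taylor_two_lt_of_forall_lt_deriv_deriv {f : ℝ → ℝ} {d x y K : ℝ} (hxy : x ≠ y)
    (hf : ContinuousOn f (Set.uIcc x y)) (hd : HasDerivWithinAt f d (Set.uIcc x y) x)
    (h1 : ∀ u ∈ Set.uIoo x y, DifferentiableAt ℝ f u)
    (h2 : ∀ u ∈ Set.uIoo x y, DifferentiableAt ℝ (deriv f) u)
    (hK : ∀ u ∈ Set.uIoo x y, K < deriv (deriv f) u) :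
    f x + d * (y - x) + K / 2 * (y - x) ^ 2 < f y := by
  set ψ : ℝ → ℝ := fun u => f u - K / 2 * (u - x) ^ 2
  have hq (u : ℝ) : HasDerivAt (fun u => K / 2 * (u - x) ^ 2) (K * (u - x)) u := by
    convert! (((hasDerivAt_id u).sub_const x).pow 2).const_mul (K / 2) using 1
    simp only [id_eq]
    ring
  have hψ' (u : ℝ) (hu : u ∈ Set.uIoo x y) : deriv ψ u = deriv f u - K * (u - x) :=
    ((h1 u hu).hasDerivAt.sub (hq u)).deriv
  have hψ'' (u : ℝ) (hu : u ∈ Set.uIoo x y) : deriv (deriv ψ) u = deriv (deriv f) u - K := by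
    have hl : HasDerivAt (fun u => K * (u - x)) K u := by
      simpa using ((hasDerivAt_id u).sub_const x).const_mul K
    have : deriv ψ =ᶠ[𝓝 u] fun u => deriv f u - K * (u - x) := by
      filter_upwards [isOpen_Ioo.mem_nhds hu] with v hv using hψ' v hv
    rw [this.deriv_eq, ((h2 u hu).hasDerivAt.fun_sub hl).deriv]
  have hψ : StrictConvexOn ℝ (Set.uIcc x y) ψ := by
    refine strictConvexOn_of_deriv2_pos (convex_uIcc x y) (hf.sub (by fun_prop)) fun u hu => ?_
    rw [Set.uIcc, interior_Icc] at hu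
    rw [Function.iterate_succ_apply, Function.iterate_one, hψ'' u hu]
    exact sub_pos.2 (hK u hu)
  have hψx : HasDerivWithinAt ψ d (Set.uIcc x y) x := by
    have := hd.fun_sub (hq x).hasDerivWithinAt
    rwa [sub_self, mul_zero, sub_zero] at this
  have := tangent_lt_of_strictConvexOn hψ Set.left_mem_uIcc Set.right_mem_uIcc hxy hψx
  simp only [ψ, sub_self] at this
  linarith

-- The Lagrange remainder survives a merely one-sided derivative at `x` because `f''` has the
-- Darboux property: if it missed the required value, it would stay on one side of it.
theorem exists_taylor_two_eq {f : ℝ → ℝ} {d x y : ℝ} (hxy : x ≠ y)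
    (hf : ContinuousOn f (Set.uIcc x y)) (hd : HasDerivWithinAt f d (Set.uIcc x y) x)
    (h1 : ∀ u ∈ Set.uIoo x y, DifferentiableAt ℝ f u)
    (h2 : ∀ u ∈ Set.uIoo x y, DifferentiableAt ℝ (deriv f) u) :
    ∃ t ∈ Set.uIoo x y, f y - f x - d * (y - x) = (y - x) ^ 2 / 2 * iteratedDeriv 2 f t := by
  have hyx : y - x ≠ 0 := sub_ne_zero.2 hxy.symm
  set K : ℝ := 2 * (f y - f x - d * (y - x)) / (y - x) ^ 2
  have hK : f x + d * (y - x) + K / 2 * (y - x) ^ 2 = f y := by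
    simp only [K]
    field_simp
    ring
  by_contra! hne
  have hne' (u : ℝ) (hu : u ∈ Set.uIoo x y) : deriv (deriv f) u ≠ K := fun h => hne u hu <| by
    rw [iteratedDeriv_succ, iteratedDeriv_one, h]
    linarith
  rcases hasDerivWithinAt_forall_lt_or_forall_gt_of_forall_ne (convex_Ioo _ _)
    (fun u hu => (h2 u hu).hasDerivAt.hasDerivWithinAt) hne' with hlt | hgt
  · have := taylor_two_lt_of_forall_lt_deriv_deriv (K := -K) hxy hf.neg hd.neg
      (fun u hu => (h1 u hu).neg)
      (fun u hu => by rw [deriv.neg']; exact (h2 u hu).neg)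
      (fun u hu => by simpa only [deriv.neg', deriv.fun_neg, neg_lt_neg_iff] using hlt u hu)
    simp only [Pi.neg_apply] at this
    linarith
  · exact (taylor_two_lt_of_forall_lt_deriv_deriv hxy hf hd h1 h2 hgt).ne hK

theorem tendsto_of_mem_uIcc {ι : Type*} {l : Filter ι} {x : ℝ} {y t : ι → ℝ}
    (hy : Tendsto y l (𝓝 x)) (ht : ∀ᶠ i in l, t i ∈ Set.uIcc x (y i)) : Tendsto t l (𝓝 x) :=
  (tendsto_const_nhds.uIcc hy).of_smallSets ht

theorem isLittleO_taylor_two {f : ℝ → ℝ} {x : ℝ} (hf : ContDiffAt ℝ 2 f x) :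
    (fun y => f y - f x - deriv f x * (y - x) - iteratedDeriv 2 f x / 2 * (y - x) ^ 2) =o[𝓝 x]
      fun y => (y - x) ^ 2 := by
  obtain ⟨U, hU, hfU⟩ := hf.contDiffOn le_rfl (by simp)
  obtain ⟨r, hr, hrU⟩ := Metric.mem_nhds_iff.1 hU
  have hx : x ∈ Metric.ball x r := Metric.mem_ball_self hr
  have := taylor_isLittleO (n := 2) (convex_ball x r) hx (hfU.mono hrU)
  rw [Metric.isOpen_ball.nhdsWithin_eq hx] at this
  refine this.congr_left fun y => ?_
  simp only [taylorWithinEval_succ, taylor_within_zero_eval,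
    iteratedDerivWithin_of_isOpen Metric.isOpen_ball hx, smul_eq_mul]
  norm_num
  ring

theorem tendsto_natCast_mul_sub_tangent {f : ℝ → ℝ} {x τ : ℝ} {y : ℕ → ℝ}
    (hf : ContDiffAt ℝ 2 f x) (hy : Tendsto y atTop (𝓝 x))
    (hτ : Tendsto (fun n : ℕ => n * (y n - x) ^ 2) atTop (𝓝 τ)) :
    Tendsto (fun n : ℕ => n * (f (y n) - f x - deriv f x * (y n - x))) atTop
      (𝓝 (iteratedDeriv 2 f x / 2 * τ)) := by
  have hrem : (fun n : ℕ => (n : ℝ) * (f (y n) - f x - deriv f x * (y n - x) -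
      iteratedDeriv 2 f x / 2 * (y n - x) ^ 2)) =o[atTop] fun n : ℕ => (n : ℝ) * (y n - x) ^ 2 :=
    (Asymptotics.isBigO_refl _ _).mul_isLittleO ((isLittleO_taylor_two hf).comp_tendsto hy)
  have hrem0 := (Asymptotics.isLittleO_one_iff ℝ).1 (hrem.trans_isBigO (hτ.isBigO_one ℝ))
  convert! hrem0.add (hτ.const_mul (iteratedDeriv 2 f x / 2)) using 2
  · ring
  · rw [zero_add]

-- The gap `f u - f y - d * (u - y)` above the tangent line at `y` is nonnegative, and by convexity
-- its value at `c` is at most its value at `x`.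
theorem second_difference_le_of_convexOn {s : Set ℝ} {f : ℝ → ℝ} {d x y c : ℝ}
    (hf : ConvexOn ℝ s f) (hx : x ∈ s) (hy : y ∈ s) (hd : HasDerivWithinAt f d s y)
    (hc : c ∈ Set.uIcc x y) :
    f x + f c - 2 * f ((x + c) / 2) ≤ 2 * (f x - f y - d * (x - y)) := by
  rw [← segment_eq_uIcc] at hc
  have hcs : c ∈ s := hf.1.segment_subset hx hy hc
  have hmid : (x + c) / 2 ∈ s := by
    convert! hf.1 hx hcs (by norm_num : (0 : ℝ) ≤ 1 / 2) (by norm_num : (0 : ℝ) ≤ 1 / 2)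
      (by norm_num) using 1
    simp only [smul_eq_mul]
    ring
  have hgap_mid := tangent_le_of_convexOn hf hy hmid hd
  have hgap_x := tangent_le_of_convexOn hf hy hx hd
  obtain ⟨a, b, ha, hb, hab, rfl⟩ := hc
  have hgap_c := hf.2 hx hy ha hb hab
  obtain rfl : b = 1 - a := by linarith
  simp only [smul_eq_mul] at hgap_c hgap_mid ⊢
  nlinarith

theorem tendsto_of_bregman_tendsto_zero {ι : Type*} {l : Filter ι} {f : ℝ → ℝ} {U : Set ℝ} {x : ℝ}
    {y d : ι → ℝ} (hU : U ∈ 𝓝 x) (hfU : StrictConvexOn ℝ U f)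
    (hf : ∀ᶠ i in l, ConvexOn ℝ (Set.uIcc x (y i)) f)
    (hd : ∀ᶠ i in l, HasDerivWithinAt f (d i) (Set.uIcc x (y i)) (y i))
    (h0 : Tendsto (fun i => f x - f (y i) - d i * (x - y i)) l (𝓝 0)) : Tendsto y l (𝓝 x) := by
  have hnotMem {c : ℝ} (hcU : c ∈ U) (hcx : c ≠ x) : ∀ᶠ i in l, c ∉ Set.uIcc x (y i) := by
    have hpos : 0 < f x + f c - 2 * f ((x + c) / 2) := by
      have := hfU.2 (mem_of_mem_nhds hU) hcU hcx.symm one_half_pos one_half_pos (add_halves 1)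
      simp only [smul_eq_mul, ← mul_add] at this
      rw [one_div_mul_eq_div, one_div_mul_eq_div] at this
      linarith
    have h0' := h0.const_mul 2
    rw [mul_zero] at h0'
    filter_upwards [hf, hd, h0'.eventually_lt_const hpos] with i hfi hdi hlt hc
    exact hlt.not_ge (second_difference_le_of_convexOn hfi Set.left_mem_uIcc Set.right_mem_uIcc
      hdi hc)
  refine tendsto_order.2 ⟨fun a ha => ?_, fun b hb => ?_⟩
  · obtain ⟨c, hcU, hac, hcx⟩ :=
      nonempty_of_mem (inter_mem (mem_nhdsWithin_of_mem_nhds hU) (Ioo_mem_nhdsLT ha))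
    filter_upwards [hnotMem hcU hcx.ne] with i hi
    by_contra! hya
    exact hi (Set.mem_uIcc.2 (.inr ⟨hya.trans hac.le, hcx.le⟩))
  · obtain ⟨c, hcU, hxc, hcb⟩ :=
      nonempty_of_mem (inter_mem (mem_nhdsWithin_of_mem_nhds hU) (Ioo_mem_nhdsGT hb))
    filter_upwards [hnotMem hcU hxc.ne'] with i hi
    by_contra! hby
    exact hi (Set.mem_uIcc.2 (.inl ⟨hxc.le, hcb.le.trans hby⟩))

theorem tendstoInMeasure_const_of_tendsto {Ω ι E : Type*} [MeasurableSpace Ω] {P : Measure Ω}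
    {l : Filter ι} [PseudoEMetricSpace E] {c : ι → E} {c₀ : E} (hc : Tendsto c l (𝓝 c₀)) :
    TendstoInMeasure P (fun i _ => c i) l fun _ => c₀ := by
  intro ε hε
  refine tendsto_const_nhds.congr' ?_
  filter_upwards [EMetric.tendsto_nhds.1 hc ε hε] with i hi
  simp [hi.not_ge]

section NormingConstants

variable {Ω Ω' ι : Type*} [MeasurableSpace Ω] [MeasurableSpace Ω'] {P : Measure Ω}
  {P' : Measure Ω'} [IsProbabilityMeasure P] [IsProbabilityMeasure P'] {l : Filter ι}

theorem tendstoInDistribution_id_of_hasLaw {E : Type*} [MeasurableSpace E] [TopologicalSpace E]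
    [OpensMeasurableSpace E] {X : ι → Ω → E} {Z : Ω' → E} {μ : Measure E} [IsProbabilityMeasure μ]
    (hX : TendstoInDistribution X l Z (fun _ => P) P')
    (hZ : HasLaw Z μ P') : TendstoInDistribution X l id (fun _ => P) μ where
  forall_aemeasurable := hX.forall_aemeasurable
  tendsto := by simpa only [hZ.map_eq, Measure.map_id] using hX.tendsto

theorem tendstoInDistribution_mul_add_of_tendsto [l.IsCountablyGenerated] {X : ι → Ω → ℝ}
    {c b : ι → ℝ} {c₀ β : ℝ} {v : NNReal}
    (hX : TendstoInDistribution X l id (fun _ => P) (gaussianReal 0 v))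
    (hc : Tendsto c l (𝓝 c₀)) (hb : Tendsto b l (𝓝 β)) :
    TendstoInDistribution (fun i ω => c i * X i ω + b i) l id (fun _ => P)
      (gaussianReal β (c₀ ^ 2 * v).toNNReal) := by
  have hlim := hX.continuous_comp_prodMk_of_tendstoInMeasure_const
    (g := fun p : ℝ × ℝ × ℝ => p.2.1 * p.1 + p.2.2) (by fun_prop)
    (tendstoInMeasure_const_of_tendsto (hc.prodMk_nhds hb)) (fun i => by fun_prop)
  refine tendstoInDistribution_id_of_hasLaw hlim ⟨by fun_prop, ?_⟩
  have hcomp : (fun z : ℝ => c₀ * id z + β) = (· + β) ∘ (c₀ * ·) := rfl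
  rw [hcomp, ← Measure.map_map (by fun_prop) (by fun_prop), gaussianReal_map_const_mul,
    gaussianReal_map_add_const]
  congr 1
  · ring
  · ext
    rw [Real.coe_toNNReal _ (by positivity)]
    rfl

-- A centered Gaussian is symmetric, so the signs of the norming constants need not stabilize: the
-- nonnegative and the negative ones are treated separately.
theorem tendstoInDistribution_mul_add_of_tendsto_sq [l.IsCountablyGenerated] {X : ι → Ω → ℝ}
    {c b : ι → ℝ} {τ β : ℝ} {v : NNReal}
    (hX : TendstoInDistribution X l id (fun _ => P) (gaussianReal 0 v))
    (hτ : 0 ≤ τ) (hc : Tendsto (fun i => c i ^ 2) l (𝓝 τ)) (hb : Tendsto b l (𝓝 β)) :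
    TendstoInDistribution (fun i ω => c i * X i ω + b i) l id (fun _ => P)
      (gaussianReal β (τ * v).toNNReal) := by
  have habs : Tendsto (fun i => |c i|) l (𝓝 (√τ)) := by
    simpa only [Real.sqrt_sq_eq_abs] using hc.sqrt
  have hrestrict (s : Set ι) {c₀ : ℝ} (hc₀ : c₀ ^ 2 = τ)
      (hcs : Tendsto c (l ⊓ 𝓟 s) (𝓝 c₀)) :=
    hc₀ ▸ tendstoInDistribution_mul_add_of_tendsto
      ⟨hX.forall_aemeasurable, hX.aemeasurable_limit, hX.tendsto.mono_left inf_le_left⟩ hcs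
      (hb.mono_left inf_le_left)
  have hnonneg := hrestrict {i | 0 ≤ c i} (Real.sq_sqrt hτ) <|
    (habs.mono_left inf_le_left).congr' <| by
      filter_upwards [mem_inf_of_right (mem_principal_self _)] with i hi using abs_of_nonneg hi
  have hneg := hrestrict {i | 0 ≤ c i}ᶜ (c₀ := -√τ) (by rw [neg_sq, Real.sq_sqrt hτ]) <|
    (habs.neg.mono_left inf_le_left).congr' <| by
      filter_upwards [mem_inf_of_right (mem_principal_self _)] with i hi
      rw [abs_of_neg (not_le.1 (Set.mem_compl_iff _ _ |>.1 hi)), neg_neg]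
  refine ⟨hnonneg.forall_aemeasurable, hnonneg.aemeasurable_limit, ?_⟩
  have hsplit : l = l ⊓ 𝓟 {i | 0 ≤ c i} ⊔ l ⊓ 𝓟 {i | 0 ≤ c i}ᶜ := by
    rw [← inf_sup_left, sup_principal, Set.union_compl_self, principal_univ, inf_top_eq]
  exact (hnonneg.tendsto.sup hneg.tendsto).mono_left hsplit.le

theorem tendstoInDistribution_mul_sum_sub_add {Y : ℕ → Ω → ℝ} (hindep : iIndepFun Y P)
    (hident : ∀ i, IdentDistrib (Y i) (Y 0) P P) (hY : MemLp (Y 0) 2 P)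
    {a b : ℕ → ℝ} {τ β : ℝ} (ha : Tendsto (fun n : ℕ => n * a n ^ 2) atTop (𝓝 τ))
    (hb : Tendsto b atTop (𝓝 β)) :
    TendstoInDistribution
      (fun (n : ℕ) ω => a n * (∑ i ∈ Finset.range n, Y i ω - n * P[Y 0]) + b n) atTop id
      (fun _ => P) (gaussianReal β (τ * Var[Y 0; P]).toNNReal) := by
  have hclt := tendstoInDistribution_inv_sqrt_mul_sum_sub
    (HasLaw.id (μ := gaussianReal 0 Var[Y 0; P].toNNReal)) hY hindep hident
  have := tendstoInDistribution_mul_add_of_tendsto_sq (c := fun n : ℕ => √n * a n) hclt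
    (ge_of_tendsto' ha fun n => by positivity) (by simpa [mul_pow] using ha) hb
  rw [Real.coe_toNNReal _ (variance_nonneg _ _)] at this
  refine this.congr (fun n => .of_forall fun ω => ?_) .rfl
  rcases eq_or_ne n 0 with rfl | hn
  · simp
  · field_simp

end NormingConstants

namespace UMPBT

section ExpFamily

variable {𝓧 : Type*} [MeasurableSpace 𝓧] {ν : Measure 𝓧} {h T : 𝓧 → ℝ} {A : ℝ → ℝ} {Θ : Set ℝ}

theorem IsExpFamily.measurable_density (hfam : IsExpFamily ν h T A Θ) (θ : ℝ) :
    Measurable (density h T A θ) := by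
  have := hfam.measurable_h
  have := hfam.measurable_T
  unfold density
  fun_prop

theorem IsExpFamily.density_nonneg (hfam : IsExpFamily ν h T A Θ) (θ : ℝ) (x : 𝓧) :
    0 ≤ density h T A θ x :=
  mul_nonneg (hfam.h_nonneg x) (Real.exp_pos _).le

theorem IsExpFamily.isProbabilityMeasure_law (hfam : IsExpFamily ν h T A Θ) {θ : ℝ}
    (hθ : θ ∈ Θ) : IsProbabilityMeasure (law ν h T A θ) :=
  ⟨by simpa [law] using hfam.lintegral_density θ hθ⟩

theorem IsExpFamily.ae_law_pos (hfam : IsExpFamily ν h T A Θ) (θ : ℝ) :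
    ∀ᵐ x ∂law ν h T A θ, 0 < h x := by
  rw [law, ae_withDensity_iff (hfam.measurable_density θ).ennreal_ofReal]
  refine Eventually.of_forall fun x hx => (hfam.h_nonneg x).lt_of_ne fun h0 => hx ?_
  simp [density, ← h0]

theorem IsExpFamily.lintegral_exp_law (hfam : IsExpFamily ν h T A Θ) (θ : ℝ) {s : ℝ}
    (hs : s ∈ Θ) :
    ∫⁻ x, ENNReal.ofReal (Real.exp ((s - θ) * T x)) ∂law ν h T A θ =
      ENNReal.ofReal (Real.exp (A s - A θ)) := by
  have hT := hfam.measurable_T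
  rw [law, lintegral_withDensity_eq_lintegral_mul _ (hfam.measurable_density θ).ennreal_ofReal
    (by fun_prop)]
  calc _ = ∫⁻ x, ENNReal.ofReal (Real.exp (A s - A θ)) *
        ENNReal.ofReal (density h T A s x) ∂ν := by
        refine lintegral_congr fun x => ?_
        rw [Pi.mul_apply, ← ENNReal.ofReal_mul (hfam.density_nonneg θ x),
          ← ENNReal.ofReal_mul (Real.exp_pos _).le]
        congr 1
        rw [density, density, mul_assoc, ← Real.exp_add, mul_left_comm, ← Real.exp_add]
        ring_nf
    _ = _ := by
        rw [lintegral_const_mul _ (hfam.measurable_density s).ennreal_ofReal,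
          hfam.lintegral_density s hs, mul_one]

theorem IsExpFamily.integrable_exp_law (hfam : IsExpFamily ν h T A Θ) (θ : ℝ) {s : ℝ}
    (hs : s ∈ Θ) : Integrable (fun x => Real.exp ((s - θ) * T x)) (law ν h T A θ) := by
  have hT := hfam.measurable_T
  refine ⟨by fun_prop, ?_⟩
  rw [hasFiniteIntegral_iff_ofReal (Eventually.of_forall fun x => (Real.exp_pos _).le),
    hfam.lintegral_exp_law θ hs]
  exact ENNReal.ofReal_lt_top

theorem IsExpFamily.cgf_law (hfam : IsExpFamily ν h T A Θ) (θ : ℝ) {s : ℝ} (hs : s ∈ Θ) :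
    cgf T (law ν h T A θ) (s - θ) = A s - A θ := by
  have hT := hfam.measurable_T
  rw [cgf, mgf, integral_eq_lintegral_of_nonneg_ae
    (Eventually.of_forall fun x => (Real.exp_pos _).le) (by fun_prop),
    hfam.lintegral_exp_law θ hs, ENNReal.toReal_ofReal (Real.exp_pos _).le, Real.log_exp]

theorem IsExpFamily.eventuallyEq_cgf (hfam : IsExpFamily ν h T A Θ) {θ : ℝ} (hθ : Θ ∈ 𝓝 θ) :
    A =ᶠ[𝓝 θ] fun s => A θ + cgf T (law ν h T A θ) (s - θ) := by
  filter_upwards [hθ] with s hs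
  rw [hfam.cgf_law θ hs]
  ring

theorem IsExpFamily.zero_mem_interior_integrableExpSet (hfam : IsExpFamily ν h T A Θ) {θ : ℝ}
    (hθ : Θ ∈ 𝓝 θ) : 0 ∈ interior (integrableExpSet T (law ν h T A θ)) := by
  rw [mem_interior_iff_mem_nhds]
  have : Tendsto (fun u => u + θ) (𝓝 0) (𝓝 θ) := by
    simpa using (continuous_add_const θ).tendsto 0
  filter_upwards [this hθ] with u hu
  simpa [integrableExpSet] using hfam.integrable_exp_law θ hu

theorem IsExpFamily.analyticAt (hfam : IsExpFamily ν h T A Θ) {θ : ℝ} (hθ : Θ ∈ 𝓝 θ) :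
    AnalyticAt ℝ A θ := by
  refine AnalyticAt.congr ?_ (hfam.eventuallyEq_cgf hθ).symm
  refine analyticAt_const.add (AnalyticAt.comp_of_eq (g := cgf T (law ν h T A θ)) (y := 0)
    (analyticAt_cgf (hfam.zero_mem_interior_integrableExpSet hθ)) ?_ (by simp))
  exact analyticAt_id.sub analyticAt_const

theorem IsExpFamily.deriv_eq_integral (hfam : IsExpFamily ν h T A Θ) {θ : ℝ} (hθ : Θ ∈ 𝓝 θ) :
    deriv A θ = ∫ x, T x ∂law ν h T A θ := by
  have := hfam.isProbabilityMeasure_law (mem_of_mem_nhds hθ)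
  rw [(hfam.eventuallyEq_cgf hθ).deriv_eq, deriv_const_add, deriv_comp_sub_const, sub_self,
    deriv_cgf_zero (hfam.zero_mem_interior_integrableExpSet hθ)]
  simp

theorem IsExpFamily.iteratedDeriv_two_eq_variance (hfam : IsExpFamily ν h T A Θ) {θ : ℝ}
    (hθ : Θ ∈ 𝓝 θ) : iteratedDeriv 2 A θ = Var[T; law ν h T A θ] := by
  have := hfam.isProbabilityMeasure_law (mem_of_mem_nhds hθ)
  have h0 := hfam.zero_mem_interior_integrableExpSet hθ
  have hT := hfam.measurable_T
  rw [(hfam.eventuallyEq_cgf hθ).iteratedDeriv_eq, iteratedDeriv_const_add two_pos,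
    congrFun (iteratedDeriv_comp_sub_const ..) θ, sub_self, iteratedDeriv_two_cgf_eq_integral h0,
    deriv_cgf_zero h0, variance_eq_integral (by fun_prop)]
  simp

theorem IsExpFamily.continuousAt_iteratedDeriv_two (hfam : IsExpFamily ν h T A Θ) {θ : ℝ}
    (hθ : Θ ∈ 𝓝 θ) : ContinuousAt (iteratedDeriv 2 A) θ := by
  rw [iteratedDeriv_succ, iteratedDeriv_one]
  exact (hfam.analyticAt hθ).deriv.deriv.continuousAt

theorem IsExpFamily.iteratedDeriv_two_nonneg (hfam : IsExpFamily ν h T A Θ) {θ : ℝ}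
    (hθ : Θ ∈ 𝓝 θ) : 0 ≤ iteratedDeriv 2 A θ :=
  hfam.iteratedDeriv_two_eq_variance hθ ▸ variance_nonneg _ _

theorem IsExpFamily.memLp_two (hfam : IsExpFamily ν h T A Θ) {θ : ℝ} (hθ : Θ ∈ 𝓝 θ) :
    MemLp T 2 (law ν h T A θ) := by
  simpa using memLp_of_mem_interior_integrableExpSet
    (hfam.zero_mem_interior_integrableExpSet hθ) 2

theorem IsExpFamily.eq_affine_of_iteratedDeriv_two_eq_zero (hfam : IsExpFamily ν h T A Θ) {θ : ℝ}
    (hθ : Θ ∈ 𝓝 θ) (h0 : iteratedDeriv 2 A θ = 0) {s : ℝ} (hs : s ∈ Θ) :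
    A s = A θ + deriv A θ * (s - θ) := by
  have := hfam.isProbabilityMeasure_law (mem_of_mem_nhds hθ)
  rw [hfam.iteratedDeriv_two_eq_variance hθ] at h0
  have hc := ae_eq_integral_of_variance_eq_zero (hfam.memLp_two hθ) h0
  have := hfam.cgf_law θ hs
  rw [cgf, mgf_congr hc, mgf_const, Real.log_exp, ← hfam.deriv_eq_integral hθ] at this
  linarith

theorem IsExpFamily.iteratedDeriv_two_pos (hfam : IsExpFamily ν h T A Θ) {θ t : ℝ}
    (hθ : Θ ∈ 𝓝 θ) (ht : Θ ∈ 𝓝 t) (h0 : iteratedDeriv 2 A t ≠ 0) : 0 < iteratedDeriv 2 A θ := by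
  refine (hfam.iteratedDeriv_two_nonneg hθ).lt_of_ne' fun hθ0 => h0 ?_
  have haff : A =ᶠ[𝓝 t] fun s => A θ + deriv A θ * (s - θ) := by
    filter_upwards [ht] with s hs using hfam.eq_affine_of_iteratedDeriv_two_eq_zero hθ hθ0 hs
  rw [haff.iteratedDeriv_eq, iteratedDeriv_succ, iteratedDeriv_one]
  simp

theorem IsExpFamily.strictConvexOn (hfam : IsExpFamily ν h T A Θ) {s : Set ℝ} (hs : Convex ℝ s)
    (hsΘ : s ⊆ Θ) (hA : ContinuousOn A s) {t : ℝ} (ht : Θ ∈ 𝓝 t) (h0 : iteratedDeriv 2 A t ≠ 0) :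
    StrictConvexOn ℝ s A := by
  refine strictConvexOn_of_deriv2_pos hs hA fun θ hθ => ?_
  rw [← iteratedDeriv_eq_iterate]
  exact hfam.iteratedDeriv_two_pos (mem_of_superset (mem_interior_iff_mem_nhds.1 hθ) hsΘ) ht h0

section Segment

variable {θ₀ θs : ℝ}

theorem IsExpFamily.uIcc_subset (hfam : IsExpFamily ν h T A Θ) (hΘ : Θ ∈ 𝓝 θ₀) (hs : θs ∈ Θ) :
    Set.uIcc θ₀ θs ⊆ Θ :=
  hfam.interval.uIcc_subset (mem_of_mem_nhds hΘ) hs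

theorem IsExpFamily.mem_nhds_of_mem_uIoo (hfam : IsExpFamily ν h T A Θ) (hΘ : Θ ∈ 𝓝 θ₀)
    (hs : θs ∈ Θ) {t : ℝ} (ht : t ∈ Set.uIoo θ₀ θs) : Θ ∈ 𝓝 t :=
  mem_of_superset (isOpen_Ioo.mem_nhds ht)
    (Set.uIoo_subset_uIcc_self.trans (hfam.uIcc_subset hΘ hs))

theorem IsExpFamily.continuousOn_uIcc (hfam : IsExpFamily ν h T A Θ) (hΘ : Θ ∈ 𝓝 θ₀)
    (hs : θs ∈ Θ) (hA : ContinuousWithinAt A Θ θs) : ContinuousOn A (Set.uIcc θ₀ θs) := by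
  intro t ht
  rcases eq_or_ne t θ₀ with rfl | h0
  · exact (hfam.analyticAt hΘ).continuousAt.continuousWithinAt
  rcases eq_or_ne t θs with rfl | h1
  · exact hA.mono (hfam.uIcc_subset hΘ hs)
  have ht' : t ∈ Set.uIoo θ₀ θs := by
    rcases Set.mem_uIcc.1 ht with ⟨hl, hr⟩ | ⟨hl, hr⟩
    · exact Set.mem_uIoo_of_lt (hl.lt_of_ne' h0) (hr.lt_of_ne h1)
    · exact Set.mem_uIoo_of_gt (hl.lt_of_ne' h1) (hr.lt_of_ne h0)
  exact (hfam.analyticAt (hfam.mem_nhds_of_mem_uIoo hΘ hs ht')).continuousAt.continuousWithinAt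

theorem IsExpFamily.exists_taylor_two_eq (hfam : IsExpFamily ν h T A Θ) (hΘ : Θ ∈ 𝓝 θ₀)
    (hs : θs ∈ Θ) (hne : θs ≠ θ₀) {d : ℝ} (hd : HasDerivWithinAt A d Θ θs) :
    ∃ t ∈ Set.uIoo θ₀ θs,
      A θ₀ - A θs - d * (θ₀ - θs) = (θs - θ₀) ^ 2 / 2 * iteratedDeriv 2 A t := by
  have hana (t : ℝ) (ht : t ∈ Set.uIoo θs θ₀) : AnalyticAt ℝ A t :=
    hfam.analyticAt (hfam.mem_nhds_of_mem_uIoo hΘ hs (Set.uIoo_comm θs θ₀ ▸ ht))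
  have hsub := hfam.uIcc_subset hΘ hs
  have hcont := hfam.continuousOn_uIcc hΘ hs hd.continuousWithinAt
  rw [Set.uIcc_comm] at hsub hcont
  obtain ⟨t, ht, htaylor⟩ := _root_.exists_taylor_two_eq hne hcont (hd.mono hsub)
    (fun t ht => (hana t ht).differentiableAt) (fun t ht => (hana t ht).deriv.differentiableAt)
  exact ⟨t, Set.uIoo_comm θs θ₀ ▸ ht, by rw [htaylor]; ring⟩

end Segment

end ExpFamily

section StationaryPoint

variable {A : ℝ → ℝ} {Θ : Set ℝ} {θ₀ γ : ℝ} {n : ℕ} {θs : ℝ}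

/-- `θs` is a parameter value at which the objective function `g_γ(·, θ₀)`, as a function on the
parameter space `Θ`, is stationary: the calculus half of `IsStationaryUMPBT`. -/
def IsStationaryPoint (A : ℝ → ℝ) (Θ : Set ℝ) (θ₀ γ : ℝ) (n : ℕ) (θs : ℝ) : Prop :=
  θs ∈ Θ ∧ HasDerivWithinAt (g A γ n θ₀) 0 Θ θs

theorem IsStationaryUMPBT.isStationaryPoint {𝓧 : Type*} [MeasurableSpace 𝓧] {ν : Measure 𝓧}
    {h T : 𝓧 → ℝ} {Θ₁ : Set ℝ} (hΘ₁ : Θ₁ ⊆ Θ) (hs : IsStationaryUMPBT ν h T A Θ Θ₁ θ₀ γ n θs) :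
    IsStationaryPoint A Θ θ₀ γ n θs :=
  ⟨hΘ₁ (by simpa [ae_dirac_eq] using hs.1.1.2), hs.2⟩

theorem g_mul_sub {θ : ℝ} (hne : θ ≠ θ₀) :
    g A γ n θ₀ θ * (θ - θ₀) = Real.log γ + n * (A θ - A θ₀) :=
  div_mul_cancel₀ _ (sub_ne_zero.2 hne)

-- The numerator of `g` tends to `log γ ≠ 0` at `θ₀`, so `g` is unbounded there.
theorem ne_of_continuousAt_g (hA : ContinuousAt A θ₀) (hγ : Real.log γ ≠ 0)
    (hg : ContinuousAt (g A γ n θ₀) θs) : θs ≠ θ₀ := by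
  rintro rfl
  have hnum : Tendsto (fun θ => g A γ n θs θ * (θ - θs)) (𝓝[≠] θs) (𝓝 (Real.log γ)) := by
    have : ContinuousAt (fun θ => Real.log γ + n * (A θ - A θs)) θs := by fun_prop
    have := this.tendsto.mono_left (nhdsWithin_le_nhds (s := {θs}ᶜ))
    rw [sub_self, mul_zero, add_zero] at this
    refine this.congr' ?_
    filter_upwards [self_mem_nhdsWithin] with θ hθ using (g_mul_sub hθ).symm
  have hzero : Tendsto (fun θ => g A γ n θs θ * (θ - θs)) (𝓝[≠] θs) (𝓝 0) := by
    have : ContinuousAt (fun θ => g A γ n θs θ * (θ - θs)) θs := by fun_prop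
    simpa using this.tendsto.mono_left nhdsWithin_le_nhds
  exact hγ (tendsto_nhds_unique hnum hzero)

theorem IsStationaryPoint.ne (hΘ : Θ ∈ 𝓝 θ₀) (hA : ContinuousAt A θ₀) (hγ : Real.log γ ≠ 0)
    (hs : IsStationaryPoint A Θ θ₀ γ n θs) : θs ≠ θ₀ := by
  rintro rfl
  exact ne_of_continuousAt_g hA hγ (hs.2.hasDerivAt hΘ).continuousAt rfl

theorem IsStationaryPoint.hasDerivWithinAt (hn : n ≠ 0) (hne : θs ≠ θ₀)
    (hs : IsStationaryPoint A Θ θ₀ γ n θs) :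
    HasDerivWithinAt A (g A γ n θ₀ θs / n) Θ θs := by
  have hA {θ : ℝ} (hθ : θ ≠ θ₀) : A θ = (g A γ n θ₀ θ * (θ - θ₀) - Real.log γ) / n + A θ₀ := by
    rw [g_mul_sub hθ]
    field_simp
    ring
  have hderiv := (((hs.2.fun_mul ((hasDerivWithinAt_id θs Θ).sub_const θ₀)).sub_const
    (Real.log γ)).div_const (n : ℝ)).add_const (A θ₀)
  simp only [id_eq, zero_mul, mul_one, zero_add] at hderiv
  refine hderiv.congr_of_eventuallyEq ?_ (hA hne)
  filter_upwards [nhdsWithin_le_nhds (isOpen_ne.mem_nhds hne)] with θ hθ using hA hθ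

theorem bregman_eq_log_div (hn : n ≠ 0) {θ : ℝ} (hne : θ ≠ θ₀) :
    A θ₀ - A θ - g A γ n θ₀ θ / n * (θ₀ - θ) = Real.log γ / n := by
  have := g_mul_sub (A := A) (γ := γ) (n := n) hne
  field_simp
  linarith

variable {𝓧 : Type*} [MeasurableSpace 𝓧] {ν : Measure 𝓧} {h T : 𝓧 → ℝ}

theorem IsStationaryPoint.exists_mul_sub_sq_mul_eq (hs : IsStationaryPoint A Θ θ₀ γ n θs)
    (hfam : IsExpFamily ν h T A Θ) (hΘ : Θ ∈ 𝓝 θ₀) (hγ : Real.log γ ≠ 0) (hn : n ≠ 0) :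
    ∃ t ∈ Set.uIoo θ₀ θs, n * (θs - θ₀) ^ 2 * iteratedDeriv 2 A t = 2 * Real.log γ := by
  have hne := hs.ne hΘ (hfam.analyticAt hΘ).continuousAt hγ
  obtain ⟨t, ht, htaylor⟩ := hfam.exists_taylor_two_eq hΘ hs.1 hne (hs.hasDerivWithinAt hn hne)
  refine ⟨t, ht, ?_⟩
  rw [bregman_eq_log_div hn hne, div_eq_iff (Nat.cast_ne_zero.2 hn)] at htaylor
  rw [htaylor]
  ring

theorem IsStationaryPoint.exists_abs_sub_eq_sqrt (hs : IsStationaryPoint A Θ θ₀ γ n θs)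
    (hfam : IsExpFamily ν h T A Θ) (hΘ : Θ ∈ 𝓝 θ₀) (hγ : Real.log γ ≠ 0) (hn : n ≠ 0) :
    ∃ t ∈ Set.uIoo θ₀ θs, |θs - θ₀| = √(2 * Real.log γ / (n * iteratedDeriv 2 A t)) := by
  obtain ⟨t, ht, heq⟩ := hs.exists_mul_sub_sq_mul_eq hfam hΘ hγ hn
  refine ⟨t, ht, ?_⟩
  have h0 : n * iteratedDeriv 2 A t ≠ 0 := fun h0 =>
    hγ (by linear_combination h0 * (θs - θ₀) ^ 2 / 2 - heq / 2)
  rw [← heq, mul_right_comm, mul_div_cancel_left₀ _ h0, Real.sqrt_sq_eq_abs]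

theorem IsStationaryPoint.iteratedDeriv_two_pos (hs : IsStationaryPoint A Θ θ₀ γ n θs)
    (hfam : IsExpFamily ν h T A Θ) (hΘ : Θ ∈ 𝓝 θ₀) (hγ : Real.log γ ≠ 0) (hn : n ≠ 0) :
    0 < iteratedDeriv 2 A θ₀ := by
  obtain ⟨t, ht, heq⟩ := hs.exists_mul_sub_sq_mul_eq hfam hΘ hγ hn
  refine hfam.iteratedDeriv_two_pos hΘ (hfam.mem_nhds_of_mem_uIoo hΘ hs.1 ht) fun h0 => hγ ?_
  simpa [h0, eq_comm] using heq

end StationaryPoint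

section StationarySequence

variable {𝓧 : Type*} [MeasurableSpace 𝓧] {ν : Measure 𝓧} {h T : 𝓧 → ℝ} {A : ℝ → ℝ} {Θ : Set ℝ}
  {θ₀ γ : ℝ} {θs : ℕ → ℝ}

theorem tendsto_of_isStationaryPoint (hfam : IsExpFamily ν h T A Θ) (hΘ : Θ ∈ 𝓝 θ₀)
    (hγ : Real.log γ ≠ 0) (hs : ∀ᶠ n in atTop, IsStationaryPoint A Θ θ₀ γ n (θs n)) :
    Tendsto θs atTop (𝓝 θ₀) := by
  have hA := (hfam.analyticAt hΘ).continuousAt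
  obtain ⟨m, hsm, hm⟩ := (hs.and (eventually_ne_atTop 0)).exists
  have hA'' := (hsm.iteratedDeriv_two_pos hfam hΘ hγ hm).ne'
  have hderiv : ∀ᶠ n : ℕ in atTop,
      HasDerivWithinAt A (g A γ n θ₀ (θs n) / n) Θ (θs n) := by
    filter_upwards [hs, eventually_ne_atTop 0] with n hsn hn
    exact hsn.hasDerivWithinAt hn (hsn.ne hΘ hA hγ)
  refine tendsto_of_bregman_tendsto_zero (f := A) (U := interior Θ)
    (d := fun n : ℕ => g A γ n θ₀ (θs n) / n) (interior_mem_nhds.2 hΘ) ?_ ?_ ?_ ?_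
  · refine hfam.strictConvexOn hfam.interval.convex.interior interior_subset (fun θ hθ => ?_) hΘ
      hA''
    exact (hfam.analyticAt (mem_interior_iff_mem_nhds.1 hθ)).continuousAt.continuousWithinAt
  · filter_upwards [hs, hderiv] with n hsn hdn
    exact (hfam.strictConvexOn (convex_uIcc _ _) (hfam.uIcc_subset hΘ hsn.1)
      (hfam.continuousOn_uIcc hΘ hsn.1 hdn.continuousWithinAt) hΘ hA'').convexOn
  · filter_upwards [hs, hderiv] with n hsn hdn using hdn.mono (hfam.uIcc_subset hΘ hsn.1)
  · refine (tendsto_const_div_atTop_nhds_zero_nat (Real.log γ)).congr' ?_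
    filter_upwards [hs, eventually_ne_atTop 0] with n hsn hn
    exact (bregman_eq_log_div hn (hsn.ne hΘ hA hγ)).symm

theorem tendsto_natCast_mul_sub_sq_of_isStationaryPoint (hfam : IsExpFamily ν h T A Θ)
    (hΘ : Θ ∈ 𝓝 θ₀) (hγ : Real.log γ ≠ 0)
    (hs : ∀ᶠ n in atTop, IsStationaryPoint A Θ θ₀ γ n (θs n)) :
    Tendsto (fun n : ℕ => n * (θs n - θ₀) ^ 2) atTop
      (𝓝 (2 * Real.log γ / iteratedDeriv 2 A θ₀)) := by
  obtain ⟨m, hsm, hm⟩ := (hs.and (eventually_ne_atTop 0)).exists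
  have hpos := hsm.iteratedDeriv_two_pos hfam hΘ hγ hm
  have hlog : ∀ᶠ n : ℕ in atTop, ∃ t ∈ Set.uIoo θ₀ (θs n),
      n * (θs n - θ₀) ^ 2 * iteratedDeriv 2 A t = 2 * Real.log γ := by
    filter_upwards [hs, eventually_ne_atTop 0] with n hsn hn
    exact hsn.exists_mul_sub_sq_mul_eq hfam hΘ hγ hn
  obtain ⟨t, ht⟩ := hlog.choice
  have htθ₀ : Tendsto t atTop (𝓝 θ₀) :=
    tendsto_of_mem_uIcc (tendsto_of_isStationaryPoint hfam hΘ hγ hs)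
      (ht.mono fun n hn => Set.uIoo_subset_uIcc_self hn.1)
  have hA''t := (hfam.continuousAt_iteratedDeriv_two hΘ).tendsto.comp htθ₀
  refine (tendsto_const_nhds.div hA''t hpos.ne').congr' ?_
  filter_upwards [ht, hA''t.eventually_ne hpos.ne'] with n hn hne
  exact (eq_div_of_mul_eq hne hn.2).symm

end StationarySequence

section WeightOfEvidence

theorem marginal_dirac {𝓧 : Type*} (h T : 𝓧 → ℝ) (A : ℝ → ℝ) {n : ℕ} (θ : ℝ) (x : Fin n → 𝓧) :
    marginal h T A (Measure.dirac θ) x = ENNReal.ofReal (sampleDensity h T A θ x) := by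
  rw [marginal, lintegral_dirac]

section Pointwise

variable {𝓧 : Type*} {h : 𝓧 → ℝ} (T : 𝓧 → ℝ) (A : ℝ → ℝ) {n : ℕ} {x : Fin n → 𝓧}

theorem density_pos {y : 𝓧} (hy : 0 < h y) (θ : ℝ) : 0 < density h T A θ y :=
  mul_pos hy (Real.exp_pos _)

theorem sampleDensity_pos (hx : ∀ i, 0 < h (x i)) (θ : ℝ) : 0 < sampleDensity h T A θ x :=
  Finset.prod_pos fun i _ => density_pos T A (hx i) θ

theorem log_sampleDensity (hx : ∀ i, 0 < h (x i)) (θ : ℝ) :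
    Real.log (sampleDensity h T A θ x) =
      ∑ i, Real.log (h (x i)) + θ * ∑ i, T (x i) - n * A θ := by
  have hlog (i : Fin n) :
      Real.log (density h T A θ (x i)) = Real.log (h (x i)) + (θ * T (x i) - A θ) := by
    rw [density, Real.log_mul (hx i).ne' (Real.exp_pos _).ne', Real.log_exp]
  rw [sampleDensity, Real.log_prod fun i _ => (density_pos T A (hx i) θ).ne']
  simp only [hlog, Finset.sum_add_distrib, Finset.sum_sub_distrib, ← Finset.mul_sum,
    Finset.sum_const, Finset.card_univ, Fintype.card_fin, nsmul_eq_mul, add_sub_assoc]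

theorem weightOfEvidence_eq (hx : ∀ i, 0 < h (x i)) (θ₀ θ₁ : ℝ) :
    weightOfEvidence h T A θ₀ θ₁ x = (θ₁ - θ₀) * ∑ i, T (x i) - n * (A θ₁ - A θ₀) := by
  have hpos := sampleDensity_pos T A hx
  rw [weightOfEvidence, bayesFactor, marginal_dirac, marginal_dirac, ENNReal.toReal_div,
    ENNReal.toReal_ofReal (hpos _).le, ENNReal.toReal_ofReal (hpos _).le,
    Real.log_div (hpos _).ne' (hpos _).ne', log_sampleDensity T A hx, log_sampleDensity T A hx]
  ring

end Pointwise

variable {𝓧 Ω : Type*} [MeasurableSpace 𝓧] [MeasurableSpace Ω] {ν : Measure 𝓧} {h T : 𝓧 → ℝ}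
  {A : ℝ → ℝ} {Θ : Set ℝ} {θ₀ γ : ℝ} {P : Measure Ω} {X : ℕ → Ω → 𝓧}

theorem ae_weightOfEvidence_eq (hfam : IsExpFamily ν h T A Θ)
    (hX : ∀ i, HasLaw (X i) (law ν h T A θ₀) P) (m θ₁ : ℝ) (n : ℕ) :
    ∀ᵐ ω ∂P, weightOfEvidence h T A θ₀ θ₁ (fun i : Fin n => X i ω) =
      (θ₁ - θ₀) * (∑ i ∈ Finset.range n, T (X i ω) - n * m) +
        -(n * (A θ₁ - A θ₀ - m * (θ₁ - θ₀))) := by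
  have hpos : ∀ᵐ ω ∂P, ∀ i, 0 < h (X i ω) := ae_all_iff.2 fun i =>
    ((hX i).ae_iff (measurableSet_setOfPred.1
      (measurableSet_lt measurable_const hfam.measurable_h))).2 (hfam.ae_law_pos θ₀)
  filter_upwards [hpos] with ω hω
  rw [weightOfEvidence_eq T A fun i => hω i,
    Fin.sum_univ_eq_sum_range (fun i => T (X i ω)) n]
  ring

variable [IsProbabilityMeasure P]

theorem tendstoInDistribution_mul_sum_statistic (hfam : IsExpFamily ν h T A Θ) (hΘ : Θ ∈ 𝓝 θ₀)
    (hX : ∀ i, HasLaw (X i) (law ν h T A θ₀) P) (hindep : iIndepFun X P) {a b : ℕ → ℝ} {τ β : ℝ}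
    (ha : Tendsto (fun n : ℕ => n * a n ^ 2) atTop (𝓝 τ)) (hb : Tendsto b atTop (𝓝 β)) :
    TendstoInDistribution
      (fun (n : ℕ) ω => a n * (∑ i ∈ Finset.range n, T (X i ω) - n * deriv A θ₀) + b n) atTop id
      (fun _ => P) (gaussianReal β (τ * iteratedDeriv 2 A θ₀).toNNReal) := by
  have hT := hfam.measurable_T
  have hmean : P[fun ω => T (X 0 ω)] = deriv A θ₀ := by
    rw [hfam.deriv_eq_integral hΘ]
    exact (hX 0).integral_comp hT.aestronglyMeasurable
  have hvar : Var[fun ω => T (X 0 ω); P] = iteratedDeriv 2 A θ₀ := by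
    rw [hfam.iteratedDeriv_two_eq_variance hΘ, ← (hX 0).map_eq,
      variance_map hT.aemeasurable (hX 0).aemeasurable]
    rfl
  have hLp : MemLp (T ∘ X 0) 2 P :=
    MemLp.comp_of_map ((hX 0).map_eq ▸ hfam.memLp_two hΘ) (hX 0).aemeasurable
  have := tendstoInDistribution_mul_sum_sub_add (hindep.comp (fun _ => T) fun _ => hT)
    (fun i => ((hX i).identDistrib (hX 0)).comp hT) hLp ha hb
  simpa only [Function.comp_def, hmean, hvar] using this

theorem tendstoInDistribution_weightOfEvidence (hfam : IsExpFamily ν h T A Θ) (hΘ : Θ ∈ 𝓝 θ₀)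
    (hγ : Real.log γ ≠ 0) {θs : ℕ → ℝ}
    (hs : ∀ᶠ n in atTop, IsStationaryPoint A Θ θ₀ γ n (θs n))
    (hX : ∀ i, HasLaw (X i) (law ν h T A θ₀) P) (hindep : iIndepFun X P) :
    TendstoInDistribution
      (fun (n : ℕ) ω => weightOfEvidence h T A θ₀ (θs n) fun i : Fin n => X i ω) atTop id
      (fun _ => P) (gaussianReal (-Real.log γ) (2 * Real.log γ).toNNReal) := by
  obtain ⟨m, hsm, hm⟩ := (hs.and (eventually_ne_atTop 0)).exists
  have hA'' := (hsm.iteratedDeriv_two_pos hfam hΘ hγ hm).ne'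
  have hsq := tendsto_natCast_mul_sub_sq_of_isStationaryPoint hfam hΘ hγ hs
  have hdrift := (tendsto_natCast_mul_sub_tangent (hfam.analyticAt hΘ).contDiffAt
    (tendsto_of_isStationaryPoint hfam hΘ hγ hs) hsq).neg
  have hlim := tendstoInDistribution_mul_sum_statistic hfam hΘ hX hindep hsq hdrift
  have hmean : iteratedDeriv 2 A θ₀ / 2 * (2 * Real.log γ / iteratedDeriv 2 A θ₀) =
      Real.log γ := by
    field_simp
  rw [div_mul_cancel₀ _ hA'', hmean] at hlim
  exact hlim.congr (fun n => (ae_weightOfEvidence_eq hfam hX _ _ n).mono fun _ h => h.symm) .rfl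

end WeightOfEvidence

end UMPBT

theorem lemma2_general {𝓧 : Type*} [MeasurableSpace 𝓧] (ν : Measure 𝓧) (h T : 𝓧 → ℝ) (A : ℝ → ℝ)
    (Θ : Set ℝ) (hfam : UMPBT.IsExpFamily ν h T A Θ) (θ₀ : ℝ) (hΘ : Θ ∈ 𝓝 θ₀)
    (γ : ℝ) (hγ : 0 < γ) (hγ_ne : γ ≠ 1) :
    (∀ n : ℕ, 0 < n → ∀ θs : ℝ, UMPBT.IsStationaryPoint A Θ θ₀ γ n θs →
      ∃ t ∈ Set.Ioo (min θ₀ θs) (max θ₀ θs),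
        |θs - θ₀| = Real.sqrt (2 * Real.log γ / (n * iteratedDeriv 2 A t))) ∧
    (∀ θs : ℕ → ℝ,
      (∀ᶠ n in atTop, UMPBT.IsStationaryPoint A Θ θ₀ γ n (θs n)) →
      ∀ (Ω : Type*) [MeasurableSpace Ω] (P : Measure Ω) [IsProbabilityMeasure P]
        (X : ℕ → Ω → 𝓧), (∀ i, HasLaw (X i) (UMPBT.law ν h T A θ₀) P) → iIndepFun X P →
        TendstoInDistribution
          (fun (n : ℕ) ω => UMPBT.weightOfEvidence h T A θ₀ (θs n) fun i : Fin n => X i ω)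
          atTop id (fun _ => P)
          (gaussianReal (-Real.log γ) (Real.toNNReal (2 * Real.log γ)))) := by
  have hlog := Real.log_ne_zero_of_pos_of_ne_one hγ hγ_ne
  exact ⟨fun n hn θs hs => hs.exists_abs_sub_eq_sqrt hfam hΘ hlog hn.ne',
    fun θs hs Ω _ P _ X hX hindep =>
      UMPBT.tendstoInDistribution_weightOfEvidence hfam hΘ hlog hs hX hindep⟩

theorem lemma2 {𝓧 : Type*} [MeasurableSpace 𝓧] (ν : Measure 𝓧) (h T : 𝓧 → ℝ) (A : ℝ → ℝ)
    (Θ Θ₁ : Set ℝ) (hfam : UMPBT.IsExpFamily ν h T A Θ) (hΘ₁ : Θ₁ ⊆ Θ)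
    (θ₀ : ℝ) (hΘ : Θ ∈ 𝓝 θ₀) (hA : UMPBT.HasThreeBoundedDerivs A θ₀)
    (γ : ℝ) (hγ : 0 < γ) (hγ_ne : γ ≠ 1) :
    (∀ n : ℕ, 0 < n → ∀ θs : ℝ, UMPBT.IsStationaryUMPBT ν h T A Θ Θ₁ θ₀ γ n θs →
      ∃ t ∈ Set.Ioo (min θ₀ θs) (max θ₀ θs),
        |θs - θ₀| = Real.sqrt (2 * Real.log γ / (n * iteratedDeriv 2 A t))) ∧
    (∀ θs : ℕ → ℝ,
      (∀ᶠ n in atTop, UMPBT.IsStationaryUMPBT ν h T A Θ Θ₁ θ₀ γ n (θs n)) →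
      ∀ (Ω : Type*) [MeasurableSpace Ω] (P : Measure Ω) [IsProbabilityMeasure P]
        (X : ℕ → Ω → 𝓧), (∀ i, HasLaw (X i) (UMPBT.law ν h T A θ₀) P) → iIndepFun X P →
        TendstoInDistribution
          (fun (n : ℕ) ω => UMPBT.weightOfEvidence h T A θ₀ (θs n) fun i : Fin n => X i ω)
          atTop id (fun _ => P)
          (gaussianReal (-Real.log γ) (Real.toNNReal (2 * Real.log γ)))) := by
  obtain ⟨hsqrt, hlim⟩ := lemma2_general ν h T A Θ hfam θ₀ hΘ γ hγ hγ_ne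
  exact ⟨fun n hn θs hs => hsqrt n hn θs (hs.isStationaryPoint hΘ₁),
    fun θs hs => hlim θs (hs.mono fun n hsn => hsn.isStationaryPoint hΘ₁)⟩
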